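/- Let $\sigma>0$ and $\delta>0$, and consider the additive white Gaussian noise channel $Y=X+Z$ with real input $X$, real output $Y$ and noise $Z\sim\mathcal N(0,\sigma^2)$ independent of $X$, used $n$ times with i.i.d. noise. The transmitter sends $0$ when it is off, so the output law is then $Q_0^{\times n}$ with $Q_0=\mathcal N(0,\sigma^2)$. A random code of blocklength $n$ with $|\mathcal M|$ messages consists of an encoder $\mathcal M\to\mathbb R^n$ and a decoder $\mathbb R^n\to\mathcal M$ that are chosen jointly at random by means of a secret key shared by the transmitter and the receiver; the message is uniform on the finite set $\mathcal M$, and the key, the message and the noise are independent. Let $Q^n$ denote the resulting law of the $n$ channel outputs, averaged over the key, the message and the noise. For $\varepsilon>0$ let $K_n(\delta,\varepsilon)$ be the largest value of $\log|\mathcal M|$ (natural logarithm) for which there is a random code of blocklength $n$ that satisfies $D(Q^n\,\|\,Q_0^{\times n})\le\delta$ and whose average probability of decoding error is at most $\varepsilon$. Then $$L \;=\; \lim_{\varepsilon\downarrow 0}\ \liminf_{n\to\infty}\ \frac{K_n(\delta,\varepsilon)}{\sqrt{n\delta}} \;=\; 1\ \sqrt{\mathrm{nat}},$$ irrespective of the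 noise power $\sigma^2$ and of $\delta$. -/

import Mathlib

open MeasureTheory ProbabilityTheory InformationTheory Filter Topology
open scoped NNReal ENNReal

namespace CovertAWGN

/-- A random code of blocklength `n` with `M` messages for a channel with real inputs and outputs:
the transmitter and the receiver share a secret key, drawn from an arbitrary probability space,
and each value of the key selects a deterministic encoder and a deterministic decoder. -/
structure RandomCode (n M : ℕ) where
  /-- The set of values of the secret key. -/
  Key : Type
  [measurableSpaceKey : MeasurableSpace Key]
  /-- The distribution of the secret key. -/
  keyLaw : Measure Key
  [isProbabilityMeasure_keyLaw : IsProbabilityMeasure keyLaw]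
  /-- The codeword assigned to a message, for each value of the key. -/
  enc : Key → Fin M → (Fin n → ℝ)
  measurable_enc : ∀ m, Measurable fun k => enc k m
  /-- The message guessed from the channel outputs, for each value of the key. -/
  dec : Key → (Fin n → ℝ) → Fin M
  measurable_dec : Measurable (Function.uncurry dec)

attribute [instance] RandomCode.measurableSpaceKey RandomCode.isProbabilityMeasure_keyLaw

/-- The law of `n` independent samples of Gaussian noise of mean zero and variance `σ ^ 2`. This is
also the law `Q₀^{×n}` of the channel outputs when the transmitter is off, that is, when it sends
the all-zero sequence. -/
noncomputable def noiseLaw (σ : ℝ≥0) (n : ℕ) : Measure (Fin n → ℝ) :=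
  Measure.pi fun _ => gaussianReal 0 (σ ^ 2)

namespace RandomCode

variable {n M : ℕ}

/-- The joint law of the secret key, the message and the noise: these are independent, and the
message is uniformly distributed. -/
noncomputable def jointLaw (C : RandomCode n M) (σ : ℝ≥0) :
    Measure (C.Key × Fin M × (Fin n → ℝ)) :=
  C.keyLaw.prod ((uniformOn (Set.univ : Set (Fin M))).prod (noiseLaw σ n))

/-- The channel outputs `Y = X + Z`, as a function of the key, the message and the noise. -/
def output (C : RandomCode n M) (p : C.Key × Fin M × (Fin n → ℝ)) : Fin n → ℝ :=
  C.enc p.1 p.2.1 + p.2.2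

/-- The law `Qⁿ` of the channel outputs induced by the random code and a uniform message, as seen
by an adversary who does not know the key. -/
noncomputable def outputLaw (C : RandomCode n M) (σ : ℝ≥0) : Measure (Fin n → ℝ) :=
  (C.jointLaw σ).map C.output

/-- The average probability of a decoding error. -/
noncomputable def errorProb (C : RandomCode n M) (σ : ℝ≥0) : ℝ :=
  (C.jointLaw σ).real {p | C.dec p.1 (C.output p) ≠ p.2.1}

end RandomCode

/-- `M` messages can be sent in `n` uses of the channel with noise variance `σ ^ 2` under the
covertness constraint `D(Qⁿ ‖ Q₀^{×n}) ≤ δ` with average probability of error at most `ε`. -/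
def Achievable (σ : ℝ≥0) (δ ε : ℝ) (n M : ℕ) : Prop :=
  0 < M ∧ ∃ C : RandomCode n M,
    klDiv (C.outputLaw σ) (noiseLaw σ n) ≤ ENNReal.ofReal δ ∧ C.errorProb σ ≤ ε

/-- The largest number of nats `K_n(δ, ε)`, that is, the largest possible value of `log M`. -/
noncomputable def maxNats (σ : ℝ≥0) (δ ε : ℝ) (n : ℕ) : EReal :=
  ⨆ (M : ℕ) (_ : Achievable σ δ ε n M), ((Real.log M : ℝ) : EReal)

end CovertAWGN

/-! Put r = √(nδ) and give the output per-symbol variance σ²(1+s) with s = 2δ/r. Then n(s -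
log(1+s))/2 ≤ ns²/4 = δ, so this is essentially the largest variance that covertness allows for
Gaussian outputs. The information carried is n log(1+s)/2 = r + O(1). Only the ratio s matters, so σ
drops out.

Achievability: let the key be an i.i.d. Gaussian codebook of power σ²s. The adversary, who averages
over it, sees exactly an i.i.d. Gaussian law (`gaussianCode_outputLaw`), so the divergence is
computed in closed form (`klDiv_gaussianPi_le`). Threshold decoding of the information density
(`exists_gaussianCode`) errs with small probability. Its mean is n log(1+s)/2 and its variance is
O(ns) = O(r), so Chebyshev's inequality (`measure_infoDensity_le_le`) puts it above (1-η)r with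
probability 1 - O(1/r), while exp((1-2η)r) false codewords rarely reach that level.

Converse: covertness bounds the output energy through the Donsker-Varadhan inequality with a
quadratic test function (`integral_output_sq_le`). A Fano-type bound against the reference output
N(0, σ²(1+s)) turns this energy into a bound on (1-ε) log M (`log_card_le`). With the same s, the
leading term is r. Dividing by r leaves the squeeze 1 ≤ liminf ≤ 1/(1-ε). -/

namespace CovertAWGN

/-! ### Gaussian densities and product measures -/

/-- The logarithm of the density of `gaussianReal a v` with respect to `gaussianReal b w`. -/
noncomputable def gaussianLLR (a : ℝ) (v : ℝ≥0) (b : ℝ) (w : ℝ≥0) (y : ℝ) : ℝ :=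
  Real.log (w / v) / 2 - (y - a) ^ 2 / (2 * v) + (y - b) ^ 2 / (2 * w)

@[fun_prop]
lemma measurable_gaussianLLR (a : ℝ) (v : ℝ≥0) (b : ℝ) (w : ℝ≥0) :
    Measurable (gaussianLLR a v b w) := by
  unfold gaussianLLR; fun_prop

lemma gaussianReal_eq_withDensity (a b : ℝ) {v w : ℝ≥0} (hv : v ≠ 0) (hw : w ≠ 0) :
    gaussianReal a v = (gaussianReal b w).withDensity
      fun y => ENNReal.ofReal (Real.exp (gaussianLLR a v b w y)) := by
  rw [gaussianReal_of_var_ne_zero _ hv, gaussianReal_of_var_ne_zero _ hw,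
    ← withDensity_mul _ (by fun_prop) (by fun_prop)]
  congr 1
  ext y
  have hv' : (0 : ℝ) < v := by positivity
  have hw' : (0 : ℝ) < w := by positivity
  rw [Pi.mul_apply, gaussianPDF, gaussianPDF,
    ← ENNReal.ofReal_mul (gaussianPDFReal_nonneg _ _ _)]
  congr 1
  simp only [gaussianPDFReal, gaussianLLR]
  have key : Real.exp (Real.log (w / v) / 2) = √(2 * Real.pi * w) * (√(2 * Real.pi * v))⁻¹ := by
    rw [← Real.sqrt_inv, ← Real.sqrt_mul (by positivity), ← Real.log_sqrt (by positivity),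
      Real.exp_log (by positivity)]
    congr 1
    field_simp
  rw [Real.exp_add, Real.exp_sub, key, neg_div, neg_div, Real.exp_neg, Real.exp_neg]
  have : √(2 * Real.pi * w) ≠ 0 := by positivity
  field_simp

lemma lintegral_pi_prod {ι : Type*} [Fintype ι] {α : ι → Type*} [∀ i, MeasurableSpace (α i)]
    (μ : ∀ i, Measure (α i)) [∀ i, IsProbabilityMeasure (μ i)] {f : ∀ i, α i → ℝ≥0∞}
    (hf : ∀ i, Measurable (f i)) :
    ∫⁻ x, ∏ i, f i (x i) ∂(Measure.pi μ) = ∏ i, ∫⁻ x, f i x ∂(μ i) := by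
  have h := iIndepFun_pi (μ := μ) (X := f) fun i => (hf i).aemeasurable
  have := lintegral_prod_eq_prod_lintegral_of_indepFun Finset.univ _ h fun i => by
    have := hf i; fun_prop
  rw [this]
  refine Finset.prod_congr rfl fun i _ => ?_
  exact (measurePreserving_eval μ i).lintegral_comp (hf i)

lemma pi_withDensity {ι : Type*} [Fintype ι] {α : ι → Type*} [∀ i, MeasurableSpace (α i)]
    (μ : ∀ i, Measure (α i)) [∀ i, IsProbabilityMeasure (μ i)] {f : ∀ i, α i → ℝ≥0∞}
    (hf : ∀ i, Measurable (f i)) [∀ i, SigmaFinite ((μ i).withDensity (f i))] :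
    Measure.pi (fun i => (μ i).withDensity (f i)) =
      (Measure.pi μ).withDensity fun x => ∏ i, f i (x i) := by
  refine Measure.pi_eq (μ := fun i => (μ i).withDensity (f i)) fun s hs => ?_
  rw [withDensity_apply _ (MeasurableSet.univ_pi hs), ← lintegral_indicator (MeasurableSet.univ_pi hs)]
  calc _ = ∫⁻ x, ∏ i, (s i).indicator (f i) (x i) ∂(Measure.pi μ) := by
        congr 1
        ext x
        by_cases hx : x ∈ Set.univ.pi s
        · rw [Set.indicator_of_mem hx]
          refine Finset.prod_congr rfl fun i _ => ?_
          rw [Set.indicator_of_mem (hx i trivial)]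
        · rw [Set.indicator_of_notMem hx]
          simp only [Set.mem_pi, not_forall] at hx
          obtain ⟨i, _, hi⟩ := hx
          exact (Finset.prod_eq_zero (Finset.mem_univ i) (Set.indicator_of_notMem hi _)).symm
    _ = _ := by
        rw [lintegral_pi_prod μ fun i => (hf i).indicator (hs i)]
        refine Finset.prod_congr rfl fun i _ => ?_
        rw [lintegral_indicator (hs i), withDensity_apply _ (hs i)]

/-- The law of independent Gaussians with means `a i` and common variance `v`. -/
noncomputable abbrev gaussianPi {n : ℕ} (a : Fin n → ℝ) (v : ℝ≥0) : Measure (Fin n → ℝ) :=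
  Measure.pi fun i => gaussianReal (a i) v

/-- The logarithm of the density of `gaussianPi a v` with respect to `gaussianPi b w`. -/
noncomputable def gaussianPiLLR {n : ℕ} (a : Fin n → ℝ) (v : ℝ≥0) (b : Fin n → ℝ) (w : ℝ≥0)
    (y : Fin n → ℝ) : ℝ :=
  ∑ i, gaussianLLR (a i) v (b i) w (y i)

/-- In this form all later expectations reduce to the energies of the noise and of the output. -/
lemma gaussianPiLLR_eq {n : ℕ} (a : Fin n → ℝ) (v : ℝ≥0) (b : Fin n → ℝ) (w : ℝ≥0)
    (y : Fin n → ℝ) : gaussianPiLLR a v b w y =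
      n * (Real.log (w / v) / 2) - (∑ i, (y i - a i) ^ 2) / (2 * v)
        + (∑ i, (y i - b i) ^ 2) / (2 * w) := by
  simp [gaussianPiLLR, gaussianLLR, Finset.sum_add_distrib, Finset.sum_div]

lemma gaussianPiLLR_swap {n : ℕ} (a : Fin n → ℝ) {v : ℝ≥0} (b : Fin n → ℝ) {w : ℝ≥0}
    (y : Fin n → ℝ) : gaussianPiLLR b w a v y = -gaussianPiLLR a v b w y := by
  rw [gaussianPiLLR_eq, gaussianPiLLR_eq, ← inv_div (w : ℝ) v, Real.log_inv]
  ring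

@[fun_prop]
lemma measurable_gaussianPiLLR {n : ℕ} (a : Fin n → ℝ) (v : ℝ≥0) (b : Fin n → ℝ) (w : ℝ≥0) :
    Measurable (gaussianPiLLR a v b w) := by
  unfold gaussianPiLLR; fun_prop

lemma gaussianPi_eq_withDensity {n : ℕ} (a b : Fin n → ℝ) {v w : ℝ≥0} (hv : v ≠ 0) (hw : w ≠ 0) :
    gaussianPi a v = (gaussianPi b w).withDensity
      fun y => ENNReal.ofReal (Real.exp (gaussianPiLLR a v b w y)) := by
  have h : ∀ i, SigmaFinite ((gaussianReal (b i) w).withDensity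
      fun y => ENNReal.ofReal (Real.exp (gaussianLLR (a i) v (b i) w y))) := fun i => by
    rw [← gaussianReal_eq_withDensity _ _ hv hw]; infer_instance
  calc _ = Measure.pi (fun i => (gaussianReal (b i) w).withDensity
      fun y => ENNReal.ofReal (Real.exp (gaussianLLR (a i) v (b i) w y))) := by
        exact congrArg Measure.pi (funext fun i => gaussianReal_eq_withDensity _ _ hv hw)
    _ = _ := by
        rw [pi_withDensity _ (by fun_prop)]
        congr 1
        ext y
        rw [gaussianPiLLR, Real.exp_sum, ENNReal.ofReal_prod_of_nonneg fun _ _ => by positivity]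

lemma lintegral_exp_gaussianPiLLR {n : ℕ} (a b : Fin n → ℝ) {v w : ℝ≥0} (hv : v ≠ 0) (hw : w ≠ 0) :
    ∫⁻ y, ENNReal.ofReal (Real.exp (gaussianPiLLR a v b w y)) ∂(gaussianPi b w) = 1 := by
  have := congrArg (fun μ => μ Set.univ) (gaussianPi_eq_withDensity a b hv hw)
  simpa using this.symm

lemma map_add_noiseLaw (σ : ℝ≥0) {n : ℕ} (a : Fin n → ℝ) :
    (noiseLaw σ n).map (a + ·) = gaussianPi a (σ ^ 2) := by
  have := Measure.pi_map_pi (μ := fun _ : Fin n => gaussianReal 0 (σ ^ 2))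
    (f := fun i x => a i + x) (by fun_prop)
  simp only [gaussianReal_map_const_add, zero_add] at this
  exact this

instance (σ : ℝ≥0) (n : ℕ) : IsProbabilityMeasure (noiseLaw σ n) := by
  unfold noiseLaw; infer_instance

/-! ### Relative entropy: variational bound and Gaussian value -/

/-- A form of the Donsker-Varadhan inequality. -/
lemma lintegral_le_klDiv_add {α : Type*} [MeasurableSpace α] {μ ν : Measure α}
    [IsProbabilityMeasure μ] [IsProbabilityMeasure ν] {f : α → ℝ} (hf : Measurable f)
    (hf0 : ∀ x, 0 ≤ f x) {c : ℝ} (hc : 0 ≤ c)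
    (hfc : ∫⁻ x, ENNReal.ofReal (Real.exp (f x - c)) ∂ν ≤ 1) :
    ∫⁻ x, ENNReal.ofReal (f x) ∂μ ≤ klDiv μ ν + ENNReal.ofReal c := by
  by_cases hac : μ ≪ ν
  swap
  · simp [hac]
  -- Fenchel-Young for `klFun`. It is applied with t the density and u = f - c; moving c to the
  -- right keeps every term nonnegative, so no integrability of f is needed in advance.
  have young (t u : ℝ) (ht : 0 ≤ t) : t * u + 1 ≤ klFun t + Real.exp u := by
    rcases ht.eq_or_lt with rfl | ht
    · simp [klFun]; positivity
    have h := Real.add_one_le_exp (u - Real.log t)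
    rw [Real.exp_sub, Real.exp_log ht, le_div_iff₀ ht] at h
    rw [klFun]
    nlinarith
  have hpt : ∀ᵐ x ∂ν, μ.rnDeriv ν x * ENNReal.ofReal (f x) + 1 ≤
      ENNReal.ofReal (klFun (μ.rnDeriv ν x).toReal) + ENNReal.ofReal (Real.exp (f x - c))
        + μ.rnDeriv ν x * ENNReal.ofReal c := by
    filter_upwards [Measure.rnDeriv_lt_top μ ν] with x hx
    set t := (μ.rnDeriv ν x).toReal with ht
    have ht0 : 0 ≤ t := ENNReal.toReal_nonneg
    rw [← ENNReal.ofReal_toReal hx.ne, ← ht, ← ENNReal.ofReal_one, ← ENNReal.ofReal_mul ht0,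
      ← ENNReal.ofReal_mul ht0, ← ENNReal.ofReal_add (mul_nonneg ht0 (hf0 x)) zero_le_one,
      ← ENNReal.ofReal_add (klFun_nonneg ht0) (by positivity),
      ← ENNReal.ofReal_add (add_nonneg (klFun_nonneg ht0) (by positivity)) (by positivity)]
    refine ENNReal.ofReal_le_ofReal ?_
    have := young t (f x - c) ht0
    linarith
  have h := lintegral_mono_ae hpt
  rw [lintegral_add_right _ measurable_const, lintegral_add_left (by fun_prop),
    lintegral_add_left (by fun_prop),
    ← klDiv_eq_lintegral_klFun_of_ac hac, lintegral_mul_const _ (by fun_prop),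
    Measure.lintegral_rnDeriv hac, lintegral_rnDeriv_mul hac (by fun_prop)] at h
  simp only [lintegral_const, measure_univ, mul_one, one_mul] at h
  have h2 : ∫⁻ x, ENNReal.ofReal (f x) ∂μ + 1 ≤ klDiv μ ν + ENNReal.ofReal c + 1 :=
    h.trans (by rw [add_right_comm]; gcongr)
  exact (ENNReal.add_le_add_iff_right ENNReal.one_ne_top).1 h2

lemma integrable_pow_gaussianReal (a : ℝ) (v : ℝ≥0) (k : ℕ) :
    Integrable (fun x => x ^ k) (gaussianReal a v) := by
  have h := (memLp_id_gaussianReal (μ := a) (v := v) k).integrable_norm_pow'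
  refine h.mono (by fun_prop) (ae_of_all _ fun x => ?_)
  simp

lemma integral_sq_gaussianReal (v : ℝ≥0) : ∫ x, x ^ 2 ∂(gaussianReal 0 v) = v := by
  have h := variance_fun_id_gaussianReal (μ := 0) (v := v)
  rw [variance_eq_integral (by fun_prop)] at h
  simpa using h

lemma integrable_comp_eval_gaussianPi {n : ℕ} (v : ℝ≥0) (i : Fin n) :
    Integrable (fun y => (y i) ^ 2) (gaussianPi (0 : Fin n → ℝ) v) :=
  (measurePreserving_eval (fun i => gaussianReal ((0 : Fin n → ℝ) i) v) i).integrable_comp_of_integrable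
    (g := fun x => x ^ 2) (integrable_pow_gaussianReal _ _ 2)

lemma integral_sum_sq_gaussianPi {n : ℕ} (v : ℝ≥0) :
    ∫ y, (∑ i, (y i) ^ 2) ∂(gaussianPi (0 : Fin n → ℝ) v) = n * v := by
  rw [integral_finsetSum _ fun i _ => integrable_comp_eval_gaussianPi v i]
  have (i : Fin n) : ∫ y, (y i) ^ 2 ∂(gaussianPi (0 : Fin n → ℝ) v) = v := by
    rw [← integral_sq_gaussianReal v]
    exact integral_comp_eval (f := fun x => x ^ 2) (by fun_prop)
  simp [this]

/-- The log-likelihood ratio is affine in the energy, whose mean under variance w is nw. The bound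
is in fact an equality, but only this direction is used. -/
lemma klDiv_gaussianPi_le {n : ℕ} {v w : ℝ≥0} (hv : v ≠ 0) (hw : w ≠ 0) :
    klDiv (gaussianPi (0 : Fin n → ℝ) w) (gaussianPi 0 v) ≤
      ENNReal.ofReal (n / 2 * (w / v - 1 - Real.log (w / v))) := by
  have hv' : (0 : ℝ) < v := by positivity
  have hw' : (0 : ℝ) < w := by positivity
  have hd := gaussianPi_eq_withDensity (0 : Fin n → ℝ) 0 hw hv
  have hac : gaussianPi (0 : Fin n → ℝ) w ≪ gaussianPi 0 v := by
    rw [hd]; exact withDensity_absolutelyContinuous _ _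
  have hllr : llr (gaussianPi (0 : Fin n → ℝ) w) (gaussianPi 0 v)
      =ᵐ[gaussianPi 0 w] gaussianPiLLR 0 w 0 v := by
    have h1 : (gaussianPi (0 : Fin n → ℝ) w).rnDeriv (gaussianPi 0 v) =ᵐ[gaussianPi 0 v]
        fun y => ENNReal.ofReal (Real.exp (gaussianPiLLR 0 w 0 v y)) := by
      conv_lhs => rw [hd]
      exact Measure.rnDeriv_withDensity _ (by fun_prop)
    filter_upwards [hac h1] with y hy
    rw [llr, hy, ENNReal.toReal_ofReal (by positivity), Real.log_exp]
  have hi (u : ℝ) : Integrable (fun y => (∑ i, (y i) ^ 2) / u)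
      (gaussianPi (0 : Fin n → ℝ) w) :=
    (integrable_finsetSum _ fun i _ => integrable_comp_eval_gaussianPi w i).div_const _
  have heq : (gaussianPiLLR (0 : Fin n → ℝ) w 0 v) = fun y => n * (Real.log (v / w) / 2) -
      (∑ i, (y i) ^ 2) / (2 * w) + (∑ i, (y i) ^ 2) / (2 * v) := by
    ext y; simp [gaussianPiLLR_eq]
  have hint : Integrable (gaussianPiLLR (0 : Fin n → ℝ) w 0 v) (gaussianPi 0 w) := by
    rw [heq]
    exact ((integrable_const _).sub (hi _)).add (hi _)
  have hI : ∫ y, gaussianPiLLR (0 : Fin n → ℝ) w 0 v y ∂(gaussianPi 0 w) =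
      n * (Real.log (v / w) / 2) - n * w / (2 * w) + n * w / (2 * v) := by
    have hs : Integrable (fun y => n * (Real.log (v / w) / 2) - (∑ i, (y i) ^ 2) / (2 * w))
        (gaussianPi (0 : Fin n → ℝ) w) := (integrable_const _).sub (hi _)
    simp_rw [heq]
    rw [integral_add hs (hi _),
      integral_sub (integrable_const _) (hi _), integral_div, integral_div,
      integral_sum_sq_gaussianPi]
    simp
  rw [klDiv_of_ac_of_integrable hac ((integrable_congr hllr).2 hint), integral_congr_ae hllr, hI,
    ← inv_div (w : ℝ) v, Real.log_inv]
  refine ENNReal.ofReal_le_ofReal (le_of_eq ?_)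
  simp
  field_simp
  ring


/-! ### Converse for a single blocklength -/

namespace RandomCode

variable {n M : ℕ}

instance [NeZero M] (C : RandomCode n M) (σ : ℝ≥0) : IsProbabilityMeasure (C.jointLaw σ) := by
  unfold jointLaw; infer_instance

lemma measurable_enc_uncurry (C : RandomCode n M) :
    Measurable fun p : C.Key × Fin M => C.enc p.1 p.2 :=
  measurable_from_prod_countable_left C.measurable_enc

@[fun_prop]
lemma measurable_enc_comp (C : RandomCode n M) :
    Measurable fun p : C.Key × Fin M × (Fin n → ℝ) => C.enc p.1 p.2.1 :=
  C.measurable_enc_uncurry.comp (by fun_prop : Measurable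
    fun p : C.Key × Fin M × (Fin n → ℝ) => (p.1, p.2.1))

@[fun_prop]
lemma measurable_output (C : RandomCode n M) : Measurable C.output := by
  unfold output; fun_prop

lemma measurableSet_error (C : RandomCode n M) :
    MeasurableSet {p : C.Key × Fin M × (Fin n → ℝ) | C.dec p.1 (C.output p) ≠ p.2.1} := by
  have h : Measurable fun p : C.Key × Fin M × (Fin n → ℝ) => C.dec p.1 (C.output p) :=
    C.measurable_dec.comp (measurable_fst.prodMk C.measurable_output)
  exact (measurableSet_eq_fun h (by fun_prop)).compl

lemma lintegral_jointLaw [NeZero M] (C : RandomCode n M) (σ : ℝ≥0)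
    {F : C.Key × Fin M × (Fin n → ℝ) → ℝ≥0∞} (hF : Measurable F) :
    ∫⁻ p, F p ∂(C.jointLaw σ) = ∫⁻ k, ∫⁻ m, ∫⁻ z, F (k, m, z) ∂(noiseLaw σ n)
      ∂(uniformOn (Set.univ : Set (Fin M))) ∂C.keyLaw := by
  rw [jointLaw, lintegral_prod _ hF.aemeasurable]
  congr 1
  ext k
  rw [lintegral_prod _ (by fun_prop)]

instance [NeZero M] (C : RandomCode n M) (σ : ℝ≥0) : IsProbabilityMeasure (C.outputLaw σ) :=
  Measure.isProbabilityMeasure_map (by fun_prop)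

/-- Change of measure: weighting by the density of `gaussianPi 0 w` with respect to the channel
law makes the output independent of the key and the message. -/
lemma lintegral_jointLaw_mul_exp [NeZero M] (C : RandomCode n M) {σ w : ℝ≥0} (hσ : σ ≠ 0)
    (hw : w ≠ 0) {F : C.Key → Fin M → (Fin n → ℝ) → ℝ≥0∞}
    (hF : Measurable fun p : C.Key × Fin M × (Fin n → ℝ) => F p.1 p.2.1 p.2.2) :
    ∫⁻ p, F p.1 p.2.1 (C.output p) * ENNReal.ofReal (Real.exp
        (gaussianPiLLR 0 w (C.enc p.1 p.2.1) (σ ^ 2) (C.output p))) ∂(C.jointLaw σ) =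
      ∫⁻ k, ∫⁻ m, ∫⁻ y, F k m y ∂(gaussianPi 0 w)
        ∂(uniformOn (Set.univ : Set (Fin M))) ∂C.keyLaw := by
  have h1 : Measurable fun p : C.Key × Fin M × (Fin n → ℝ) => F p.1 p.2.1 (C.output p) :=
    hF.comp (by fun_prop : Measurable
      fun p : C.Key × Fin M × (Fin n → ℝ) => (p.1, p.2.1, C.output p))
  have h2 : Measurable fun p : C.Key × Fin M × (Fin n → ℝ) =>
      gaussianPiLLR 0 w (C.enc p.1 p.2.1) (σ ^ 2) (C.output p) := by
    simp only [gaussianPiLLR_eq]; fun_prop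
  refine (C.lintegral_jointLaw σ (h1.mul h2.exp.ennreal_ofReal)).trans ?_
  congr 1; ext k; congr 1; ext m
  have hFk : Measurable (F k m) :=
    hF.comp (by fun_prop : Measurable fun y : Fin n → ℝ => (k, m, y))
  rw [gaussianPi_eq_withDensity (0 : Fin n → ℝ) (C.enc k m) hw (pow_ne_zero 2 hσ),
    lintegral_withDensity_eq_lintegral_mul _ (by fun_prop) hFk, ← map_add_noiseLaw,
    lintegral_map (by fun_prop) (by fun_prop)]
  simp only [output, Pi.mul_apply, mul_comm]

lemma uniformOn_univ_singleton (m : Fin M) :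
    uniformOn (Set.univ : Set (Fin M)) {m} = (M : ℝ≥0∞)⁻¹ := by
  rw [uniformOn_univ]; simp

/-- When y is independent of the message, any guess is correct with probability 1/M. Correct guesses
thus contribute M · (1/M) = 1, and the others at most 1. -/
lemma lintegral_decoder_le [NeZero M] (C : RandomCode n M) (μ : Measure (Fin n → ℝ))
    [IsProbabilityMeasure μ] :
    ∫⁻ k, ∫⁻ m, ∫⁻ y, (if C.dec k y = m then (M : ℝ≥0∞) else 1) ∂μ
        ∂(uniformOn (Set.univ : Set (Fin M))) ∂C.keyLaw ≤ 2 := by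
  calc _ ≤ ∫⁻ _, (2 : ℝ≥0∞) ∂C.keyLaw := by
        refine lintegral_mono fun k => ?_
        have hm : Measurable (C.dec k) :=
          C.measurable_dec.comp (by fun_prop : Measurable fun y : Fin n → ℝ => (k, y))
        have hmeas : Measurable fun p : Fin M × (Fin n → ℝ) =>
            if C.dec k p.2 = p.1 then (M : ℝ≥0∞) else 1 :=
          Measurable.ite (measurableSet_eq_fun (by fun_prop) (by fun_prop)) (by fun_prop)
            (by fun_prop)
        rw [lintegral_lintegral_swap hmeas.aemeasurable]
        calc _ ≤ ∫⁻ _, (2 : ℝ≥0∞) ∂μ := by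
              refine lintegral_mono fun y => ?_
              calc _ ≤ ∫⁻ m, (1 + ({C.dec k y} : Set (Fin M)).indicator (fun _ => (M : ℝ≥0∞)) m)
                    ∂(uniformOn (Set.univ : Set (Fin M))) := by
                    refine lintegral_mono fun m => ?_
                    by_cases h : C.dec k y = m
                    · simp [h]
                    · simp [h]
                _ = 2 := by
                  rw [lintegral_add_left (by fun_prop), lintegral_indicator_const (by simp),
                    uniformOn_univ_singleton, ENNReal.mul_inv_cancel (by simp [NeZero.ne M])
                    (by simp)]
                  simp [one_add_one_eq_two]
          _ = 2 := by simp
    _ = 2 := by simp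

/-- The output power allowed by the covertness constraint. -/
lemma integral_output_sq_le [NeZero M] (C : RandomCode n M) {σ : ℝ≥0} (hσ : σ ≠ 0) {δ : ℝ}
    (hδ : 0 ≤ δ) (hkl : klDiv (C.outputLaw σ) (noiseLaw σ n) ≤ ENNReal.ofReal δ)
    {s : ℝ≥0} (hs : s ≠ 0) :
    Integrable (fun p => ∑ i, (C.output p i) ^ 2) (C.jointLaw σ) ∧
    (∫ p, (∑ i, (C.output p i) ^ 2) ∂(C.jointLaw σ)) / (2 * (σ ^ 2 * (1 + s) : ℝ)) ≤
      (δ + n / 2 * Real.log (1 + s)) / s := by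
  set v := σ ^ 2 with hv
  set w : ℝ≥0 := v * (1 + s) with hw
  have hσ' : (0 : ℝ) < σ := by positivity
  have hs' : (0 : ℝ) < s := by positivity
  have hv0 : v ≠ 0 := pow_ne_zero 2 hσ
  have hw0 : w ≠ 0 := by positivity
  have hwr : (w : ℝ) = σ ^ 2 * (1 + s) := by simp [hw, hv]
  have hw' : (0 : ℝ) < w := by positivity
  set c : ℝ := n / 2 * Real.log (1 + s) with hc
  have hc0 : 0 ≤ c := mul_nonneg (by positivity) (Real.log_nonneg (by linarith))
  set f : (Fin n → ℝ) → ℝ := fun y => s / (2 * w) * ∑ i, (y i) ^ 2 with hf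
  have hfm : Measurable f := by fun_prop
  have hf0 : ∀ y, 0 ≤ f y := fun y => by positivity
  -- The coefficient s/(2w) and the constant c are chosen so that exp(f - c) is exactly a Gaussian
  -- density, hence has integral 1 under the noise law.
  have hfc : ∀ y, f y - c = gaussianPiLLR 0 w 0 v y := fun y => by
    have : ((v : ℝ) / w) = (1 + s : ℝ)⁻¹ := by rw [hwr, hv]; push_cast; field_simp
    rw [gaussianPiLLR_eq, this, Real.log_inv, hf, hc]
    simp only [Pi.zero_apply, sub_zero, hwr, hv, NNReal.coe_pow]
    field_simp
    ring
  have hq : ∫⁻ p, ENNReal.ofReal (f (C.output p)) ∂(C.jointLaw σ) ≤ ENNReal.ofReal (δ + c) := by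
    rw [← lintegral_map (f := fun y => ENNReal.ofReal (f y)) (by fun_prop) C.measurable_output,
      ENNReal.ofReal_add hδ hc0]
    refine (lintegral_le_klDiv_add (μ := C.outputLaw σ) (ν := noiseLaw σ n) hfm hf0 hc0 ?_).trans
      (by gcongr)
    simp_rw [hfc]
    exact (lintegral_exp_gaussianPiLLR (0 : Fin n → ℝ) 0 hw0 hv0).le
  have hfi : Integrable (fun p => f (C.output p)) (C.jointLaw σ) := by
    refine (lintegral_ofReal_ne_top_iff_integrable (by fun_prop)
      (ae_of_all _ fun p => hf0 _)).1 (hq.trans_lt ENNReal.ofReal_lt_top).ne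
  have hint : ∫ p, f (C.output p) ∂(C.jointLaw σ) ≤ δ + c := by
    rw [integral_eq_lintegral_of_nonneg_ae (ae_of_all _ fun p => hf0 _) (by fun_prop)]
    exact ENNReal.toReal_le_of_le_ofReal (by positivity) hq
  have hne : (s : ℝ) / (2 * w) ≠ 0 := by positivity
  simp only [hf] at hfi hint
  rw [integral_const_mul] at hint
  refine ⟨(integrable_const_mul_iff hne.isUnit _).1 hfi, ?_⟩
  rw [le_div_iff₀ hs', ← hwr]
  calc _ = _ := by ring
    _ ≤ _ := hint

/-- A Fano inequality by change of measure. With L the log-ratio of the channel law to N(0, w) at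
the output, and U equal to log M on correct decoding minus L, one has E exp(U) ≤ 2. Hence E U ≤ 1,
that is (1 - P(error)) log M ≤ 1 + E L. The mean of L involves only the known noise energy and the
bounded output energy. -/
theorem log_card_le [NeZero M] (C : RandomCode n M) {σ : ℝ≥0} (hσ : σ ≠ 0) {δ ε : ℝ}
    (hδ : 0 ≤ δ) (hkl : klDiv (C.outputLaw σ) (noiseLaw σ n) ≤ ENNReal.ofReal δ)
    (herr : C.errorProb σ ≤ ε) {s : ℝ≥0} (hs : s ≠ 0) :
    (1 - ε) * Real.log M ≤
      1 + n / 2 * Real.log (1 + s) - n / 2 + (δ + n / 2 * Real.log (1 + s)) / s := by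
  obtain ⟨hYi, hY⟩ := C.integral_output_sq_le hσ hδ hkl hs
  set v := σ ^ 2 with hv
  set w : ℝ≥0 := v * (1 + s) with hw
  have hσ' : (0 : ℝ) < σ := by positivity
  have hs' : (0 : ℝ) < s := by positivity
  have hv0 : v ≠ 0 := pow_ne_zero 2 hσ
  have hw0 : w ≠ 0 := by positivity
  have hvr : (v : ℝ) = σ ^ 2 := by simp [hv]
  have hwr : (w : ℝ) = σ ^ 2 * (1 + s) := by simp [hw, hv]
  have hM : (1 : ℝ) ≤ M := by exact_mod_cast NeZero.one_le
  set J := C.jointLaw σ with hJ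
  set E := {p : C.Key × Fin M × (Fin n → ℝ) | C.dec p.1 (C.output p) ≠ p.2.1} with hE
  have hEm : MeasurableSet E := C.measurableSet_error
  set L : C.Key × Fin M × (Fin n → ℝ) → ℝ := fun p =>
    gaussianPiLLR (C.enc p.1 p.2.1) v 0 w (C.output p) with hL
  have hZmp : MeasurePreserving (fun p : C.Key × Fin M × (Fin n → ℝ) => p.2.2) J
      (gaussianPi 0 v) :=
    measurePreserving_snd.comp (measurePreserving_snd (μ := C.keyLaw)
      (ν := (uniformOn (Set.univ : Set (Fin M))).prod (noiseLaw σ n)))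
  have hZi0 : Integrable (fun z => ∑ i, (z i) ^ 2) (gaussianPi (0 : Fin n → ℝ) v) :=
    integrable_finsetSum _ fun i _ => integrable_comp_eval_gaussianPi v i
  have hZi : Integrable (fun p => ∑ i, (p.2.2 i) ^ 2) J :=
    hZmp.integrable_comp_of_integrable hZi0
  have hZ : ∫ p, (∑ i, (p.2.2 i) ^ 2) ∂J = n * v := by
    rw [← integral_sum_sq_gaussianPi v, ← hZmp.map_eq,
      integral_map (by fun_prop) (Measurable.aestronglyMeasurable (by fun_prop))]
  have hLeq : L = fun p => (n * (Real.log (1 + s) / 2) - (∑ i, (p.2.2 i) ^ 2) / (2 * v)) +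
      (∑ i, (C.output p i) ^ 2) / (2 * w) := by
    ext p
    have : (w : ℝ) / v = 1 + s := by rw [hwr, hvr]; field_simp
    simp [hL, gaussianPiLLR_eq, output, this]
  have hL1 : Integrable (fun p : C.Key × Fin M × (Fin n → ℝ) =>
      n * (Real.log (1 + s) / 2) - (∑ i, (p.2.2 i) ^ 2) / (2 * v)) J :=
    (integrable_const _).sub (hZi.div_const _)
  have hLi : Integrable L J := by
    rw [hLeq]; exact hL1.add (hYi.div_const _)
  have hLint : ∫ p, L p ∂J ≤ n / 2 * Real.log (1 + s) - n / 2 +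
      (δ + n / 2 * Real.log (1 + s)) / s := by
    rw [hLeq, integral_add hL1 (hYi.div_const _), integral_sub (integrable_const _)
      (hZi.div_const _), integral_div, integral_div, hZ, hwr, hvr]
    simp only [integral_const, probReal_univ, one_smul]
    have : (n : ℝ) * σ ^ 2 / (2 * σ ^ 2) = n / 2 := by field_simp
    rw [this]
    linarith
  set U : C.Key × Fin M × (Fin n → ℝ) → ℝ := fun p =>
    Eᶜ.indicator (fun _ => Real.log M) p - L p with hU
  have hI : Integrable (Eᶜ.indicator fun _ => Real.log M) J :=
    (integrable_const _).indicator hEm.compl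
  have hUi : Integrable U J := hI.sub hLi
  have hUint : ∫ p, U p ∂J = (1 - J.real E) * Real.log M - ∫ p, L p ∂J := by
    rw [hU, integral_sub hI hLi, integral_indicator_const _ hEm.compl, probReal_compl_eq_one_sub hEm,
      smul_eq_mul]
  -- The factor exp(-L) replaces the channel by an output independent of the message, and exp of the
  -- indicator term is M or 1.
  have hexp : ∫⁻ p, ENNReal.ofReal (Real.exp (U p)) ∂J ≤ ENNReal.ofReal 2 := by
    have hF : Measurable fun p : C.Key × Fin M × (Fin n → ℝ) =>
        if C.dec p.1 p.2.2 = p.2.1 then (M : ℝ≥0∞) else 1 :=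
      Measurable.ite (measurableSet_eq_fun (C.measurable_dec.comp (by fun_prop : Measurable
        fun p : C.Key × Fin M × (Fin n → ℝ) => (p.1, p.2.2))) (by fun_prop)) (by fun_prop)
        (by fun_prop)
    have h := C.lintegral_jointLaw_mul_exp hσ hw0
      (F := fun k m y => if C.dec k y = m then (M : ℝ≥0∞) else 1) hF
    rw [ENNReal.ofReal_ofNat]
    refine le_trans (le_of_eq ?_) (h.le.trans (C.lintegral_decoder_le _))
    refine lintegral_congr fun p => ?_
    simp only [hU, hL]
    rw [sub_eq_add_neg, Real.exp_add, ENNReal.ofReal_mul (by positivity), ← gaussianPiLLR_swap]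
    congr 1
    by_cases hp : C.dec p.1 (C.output p) = p.2.1
    · have : p ∈ Eᶜ := by simpa [hE] using hp
      rw [Set.indicator_of_mem this, if_pos hp, Real.exp_log (by linarith)]
      simp
    · have : p ∉ Eᶜ := by simpa [hE] using hp
      rw [Set.indicator_of_notMem this, if_neg hp]
      simp
  have hexpi : Integrable (fun p => Real.exp (U p)) J :=
    (lintegral_ofReal_ne_top_iff_integrable
      (Real.continuous_exp.comp_aestronglyMeasurable hUi.aestronglyMeasurable)
      (ae_of_all _ fun p => (Real.exp_pos _).le)).1 (hexp.trans_lt ENNReal.ofReal_lt_top).ne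
  have hexpint : ∫ p, Real.exp (U p) ∂J ≤ 2 := by
    rw [integral_eq_lintegral_of_nonneg_ae (ae_of_all _ fun p => (Real.exp_pos _).le)
      hexpi.aestronglyMeasurable]
    exact ENNReal.toReal_le_of_le_ofReal (by positivity) hexp
  -- The tangent bound 1 + U ≤ exp U stands in for Jensen's inequality and costs only a constant.
  have hmono : ∫ p, (U p + 1) ∂J ≤ ∫ p, Real.exp (U p) ∂J :=
    integral_mono (hUi.add (integrable_const _)) hexpi fun p => Real.add_one_le_exp _
  rw [integral_add hUi (integrable_const _), hUint] at hmono
  simp only [integral_const, probReal_univ, one_smul] at hmono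
  have herr' : J.real E ≤ ε := herr
  have : (1 - ε) * Real.log M ≤ (1 - J.real E) * Real.log M :=
    mul_le_mul_of_nonneg_right (by linarith) (Real.log_nonneg hM)
  linarith

end RandomCode


/-! ### Gaussian random coding and threshold decoding -/

variable {n M : ℕ}

lemma measurePreserving_add_gaussianPi (u v : ℝ≥0) :
    MeasurePreserving (fun q : (Fin n → ℝ) × (Fin n → ℝ) => q.1 + q.2)
      ((gaussianPi 0 u).prod (gaussianPi 0 v)) (gaussianPi 0 (u + v)) := by
  refine ⟨by fun_prop, ?_⟩
  have h1 := measurePreserving_arrowProdEquivProdArrow ℝ ℝ (Fin n)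
    (fun _ => gaussianReal 0 u) (fun _ => gaussianReal 0 v)
  change Measure.map _ ((Measure.pi fun _ => gaussianReal 0 u).prod
    (Measure.pi fun _ => gaussianReal 0 v)) = _
  rw [← h1.map_eq, Measure.map_map (by fun_prop) h1.measurable]
  have h2 := Measure.pi_map_pi
    (μ := fun _ : Fin n => (gaussianReal 0 u).prod (gaussianReal 0 v))
    (f := fun _ q => q.1 + q.2) (by fun_prop)
  have h3 : ((gaussianReal 0 u).prod (gaussianReal 0 v)).map (fun q => q.1 + q.2) =
      gaussianReal 0 (u + v) := by
    have := gaussianReal_conv_gaussianReal (m₁ := 0) (m₂ := 0) (v₁ := u) (v₂ := v)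
    rwa [add_zero] at this
  simp only [h3] at h2
  exact h2

lemma measurePreserving_eval_pair {α : Type*} [MeasurableSpace α] (μ : Measure α)
    [IsProbabilityMeasure μ] {i j : Fin M} (hij : i ≠ j) :
    MeasurePreserving (fun k : Fin M → α => (k i, k j)) (Measure.pi fun _ => μ) (μ.prod μ) := by
  refine ⟨by fun_prop, ?_⟩
  have h := (iIndepFun_pi (μ := fun _ : Fin M => μ) (X := fun _ x => x)
    fun _ => aemeasurable_id).indepFun hij
  rw [(indepFun_iff_map_prod_eq_prod_map_map (measurable_pi_apply i).aemeasurable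
    (measurable_pi_apply j).aemeasurable).1 h]
  congr
  · exact (measurePreserving_eval (fun _ => μ) i).map_eq
  · exact (measurePreserving_eval (fun _ => μ) j).map_eq

/-- Putting the message outermost reduces averages over the code to bounds uniform in a fixed
message. -/
lemma RandomCode.lintegral_jointLaw_swap [NeZero M] (C : RandomCode n M) (σ : ℝ≥0)
    {F : C.Key × Fin M × (Fin n → ℝ) → ℝ≥0∞} (hF : Measurable F) :
    ∫⁻ p, F p ∂(C.jointLaw σ) = ∫⁻ m, ∫⁻ q, F (q.1, m, q.2) ∂(C.keyLaw.prod (noiseLaw σ n))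
      ∂(uniformOn (Set.univ : Set (Fin M))) := by
  rw [C.lintegral_jointLaw σ hF, lintegral_lintegral_swap]
  · congr 1
    ext m
    rw [lintegral_prod _ (by fun_prop)]
  · have : Measurable fun q : (C.Key × Fin M) × (Fin n → ℝ) => F (q.1.1, q.1.2, q.2) := by fun_prop
    exact this.lintegral_prod_right'.aemeasurable

/-- The codewords are independent Gaussian vectors, and the key is the whole codebook. -/
noncomputable def gaussianCode (u : ℝ≥0) (dec : (Fin M → Fin n → ℝ) × (Fin n → ℝ) → Fin M)
    (hdec : Measurable dec) : RandomCode n M where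
  Key := Fin M → Fin n → ℝ
  keyLaw := Measure.pi fun _ => gaussianPi 0 u
  enc k m := k m
  measurable_enc m := by fun_prop
  dec k y := dec (k, y)
  measurable_dec := hdec

lemma gaussianCode_outputLaw [NeZero M] (u : ℝ≥0)
    {dec : (Fin M → Fin n → ℝ) × (Fin n → ℝ) → Fin M} (hdec : Measurable dec) (σ : ℝ≥0) :
    (gaussianCode u dec hdec).outputLaw σ = gaussianPi 0 (u + σ ^ 2) := by
  refine Measure.ext_of_lintegral _ fun f hf => ?_
  rw [RandomCode.outputLaw, lintegral_map hf (RandomCode.measurable_output _)]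
  refine (RandomCode.lintegral_jointLaw_swap _ _
    (hf.comp (RandomCode.measurable_output _))).trans ?_
  have h (m : Fin M) : MeasurePreserving
      (fun q : (Fin M → Fin n → ℝ) × (Fin n → ℝ) => q.1 m + q.2)
      ((Measure.pi fun _ => gaussianPi 0 u).prod (noiseLaw σ n)) (gaussianPi 0 (u + σ ^ 2)) :=
    (measurePreserving_add_gaussianPi u (σ ^ 2)).comp
      ((measurePreserving_eval (fun _ : Fin M => gaussianPi (0 : Fin n → ℝ) u) m).prod
        (MeasurePreserving.id (noiseLaw σ n)))
  calc _ = ∫⁻ _, ∫⁻ y, f y ∂(gaussianPi 0 (u + σ ^ 2)) ∂(uniformOn (Set.univ : Set (Fin M))) :=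
        lintegral_congr fun m => (h m).lintegral_comp hf
    _ = _ := by simp

/-- A decoder that returns the message whose test is the only one to succeed. -/
lemma exists_measurable_decoder [NeZero M] {α : Type*} [MeasurableSpace α] {A : Fin M → Set α}
    (hA : ∀ m, MeasurableSet (A m)) :
    ∃ dec : α → Fin M, Measurable dec ∧ ∀ p m, p ∈ A m → (∀ m' ≠ m, p ∉ A m') → dec p = m := by
  obtain ⟨f, hf, h⟩ := exists_measurable_piecewise
    (fun m => A m ∩ ⋂ m' : Fin M, ⋂ _ : m' ≠ m, (A m')ᶜ)
    (fun m => (hA m).inter (MeasurableSet.iInter fun m' => MeasurableSet.iInter fun _ =>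
      (hA m').compl)) (fun m _ => m) (fun m => measurable_const) (by
      rintro i j hij x ⟨⟨h1, _⟩, ⟨_, h2⟩⟩
      simp only [Set.mem_iInter] at h2
      exact absurd h1 (h2 i hij))
  refine ⟨f, hf, fun p m h1 h2 => h m ⟨h1, ?_⟩⟩
  simpa using h2

/-- The information density of the pair `(x, y)`. -/
noncomputable def infoDensity (v w : ℝ≥0) (q : (Fin n → ℝ) × (Fin n → ℝ)) : ℝ :=
  gaussianPiLLR q.1 v 0 w q.2

@[fun_prop]
lemma measurable_infoDensity (v w : ℝ≥0) : Measurable (infoDensity (n := n) v w) := by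
  unfold infoDensity
  simp only [gaussianPiLLR_eq]
  fun_prop

/-- Markov's inequality for exp of the information density: for each x this is a probability density
with respect to the reference output law, so its mean under the product measure is 1. -/
lemma measure_infoDensity_ge_le (μ : Measure (Fin n → ℝ)) [IsProbabilityMeasure μ] {v w : ℝ≥0}
    (hv : v ≠ 0) (hw : w ≠ 0) (γ : ℝ) :
    (μ.prod (gaussianPi 0 w)) {q | γ < infoDensity v w q} ≤ ENNReal.ofReal (Real.exp (-γ)) := by
  have hm : MeasurableSet {q : (Fin n → ℝ) × (Fin n → ℝ) | γ < infoDensity v w q} :=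
    measurableSet_lt (by fun_prop) (by fun_prop)
  calc _ = ∫⁻ q, {q | γ < infoDensity v w q}.indicator 1 q ∂(μ.prod (gaussianPi 0 w)) :=
        (lintegral_indicator_one hm).symm
    _ ≤ ∫⁻ q, ENNReal.ofReal (Real.exp (-γ)) * ENNReal.ofReal (Real.exp (infoDensity v w q))
          ∂(μ.prod (gaussianPi 0 w)) := by
        refine lintegral_mono (Set.indicator_le fun q hq => ?_)
        rw [← ENNReal.ofReal_mul (by positivity), ← Real.exp_add, Pi.one_apply,
          ENNReal.one_le_ofReal, Real.one_le_exp_iff]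
        simp only [Set.mem_ofPred_eq] at hq
        linarith
    _ = ENNReal.ofReal (Real.exp (-γ)) := by
        rw [lintegral_const_mul _ (by fun_prop), lintegral_prod _ (by fun_prop)]
        simp only [infoDensity, lintegral_exp_gaussianPiLLR _ _ hv hw]
        simp

/-- Shannon's random coding bound. An error requires either that the true codeword fails the
threshold test or that some other codeword passes it. -/
lemma exists_gaussianCode [NeZero M] {σ : ℝ≥0} (hσ : σ ≠ 0) (u : ℝ≥0) (γ : ℝ) :
    ∃ C : RandomCode n M, C.outputLaw σ = gaussianPi 0 (u + σ ^ 2) ∧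
      C.errorProb σ ≤ ((gaussianPi (0 : Fin n → ℝ) u).prod (gaussianPi 0 (σ ^ 2))).real
        {q | infoDensity (σ ^ 2) (u + σ ^ 2) (q.1, q.1 + q.2) ≤ γ} + M * Real.exp (-γ) := by
  set v := σ ^ 2 with hv
  have hv0 : v ≠ 0 := pow_ne_zero 2 hσ
  have hw0 : u + v ≠ 0 := by positivity
  set A : Fin M → Set ((Fin M → Fin n → ℝ) × (Fin n → ℝ)) :=
    fun m => {p | γ < infoDensity v (u + v) (p.1 m, p.2)} with hA
  have hAm : ∀ m, MeasurableSet (A m) := fun m => measurableSet_lt (by fun_prop) (by fun_prop)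
  obtain ⟨dec, hdec, hdec'⟩ := exists_measurable_decoder hAm
  refine ⟨gaussianCode u dec hdec, gaussianCode_outputLaw u hdec σ, ?_⟩
  set C := gaussianCode u dec hdec with hC
  set P := ((gaussianPi (0 : Fin n → ℝ) u).prod (gaussianPi 0 v))
  set B := {q : (Fin n → ℝ) × (Fin n → ℝ) | infoDensity v (u + v) (q.1, q.1 + q.2) ≤ γ} with hB
  have hBm : MeasurableSet B := measurableSet_le (by fun_prop) (by fun_prop)
  set K : Measure (Fin M → Fin n → ℝ) := Measure.pi fun _ => gaussianPi 0 u with hK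
  have hmiss (m : Fin M) : MeasurePreserving
      (fun q : (Fin M → Fin n → ℝ) × (Fin n → ℝ) => (q.1 m, q.2)) (K.prod (noiseLaw σ n)) P :=
    (measurePreserving_eval (fun _ : Fin M => gaussianPi (0 : Fin n → ℝ) u) m).prod
      (MeasurePreserving.id (noiseLaw σ n))
  -- A codeword that was not sent is independent of the one sent and of the noise, hence of the
  -- output.
  have hfalse (m m' : Fin M) (h : m' ≠ m) : MeasurePreserving
      (fun q : (Fin M → Fin n → ℝ) × (Fin n → ℝ) => (q.1 m', q.1 m + q.2))
      (K.prod (noiseLaw σ n)) ((gaussianPi 0 u).prod (gaussianPi 0 (u + v))) :=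
    ((MeasurePreserving.id (gaussianPi (0 : Fin n → ℝ) u)).prod
      (measurePreserving_add_gaussianPi u v)).comp
      ((measurePreserving_prodAssoc (gaussianPi (0 : Fin n → ℝ) u) (gaussianPi 0 u)
        (gaussianPi 0 v)).comp
      ((measurePreserving_eval_pair (gaussianPi (0 : Fin n → ℝ) u) h).prod
        (MeasurePreserving.id (noiseLaw σ n))))
  have herr (m : Fin M) : (K.prod (noiseLaw σ n)) {q | dec (q.1, q.1 m + q.2) ≠ m} ≤
      P B + M * ENNReal.ofReal (Real.exp (-γ)) := by
    have hsub : {q : (Fin M → Fin n → ℝ) × (Fin n → ℝ) | dec (q.1, q.1 m + q.2) ≠ m} ⊆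
        (fun q => (q.1 m, q.2)) ⁻¹' B ∪ ⋃ m' ∈ Finset.univ.erase m,
          (fun q => (q.1 m', q.1 m + q.2)) ⁻¹' {q | γ < infoDensity v (u + v) q} := by
      intro q hq
      by_contra hcon
      simp only [Set.mem_union, Set.mem_iUnion, Set.mem_preimage, Finset.mem_erase,
        Finset.mem_univ, and_true, not_or, not_exists, hB, Set.mem_ofPred_eq] at hcon
      exact hq (hdec' _ m (not_le.1 hcon.1) fun m' hm' => hcon.2 m' hm')
    refine (measure_mono hsub).trans ((measure_union_le _ _).trans ?_)
    rw [(hmiss m).measure_preimage hBm.nullMeasurableSet]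
    gcongr
    refine (measure_biUnion_finset_le _ _).trans ?_
    calc _ ≤ ∑ m' ∈ Finset.univ.erase m, ENNReal.ofReal (Real.exp (-γ)) := by
          refine Finset.sum_le_sum fun m' hm' => ?_
          rw [(hfalse m m' (Finset.ne_of_mem_erase hm')).measure_preimage
            (measurableSet_lt (by fun_prop) (by fun_prop)).nullMeasurableSet]
          exact measure_infoDensity_ge_le _ hv0 hw0 γ
      _ ≤ M * ENNReal.ofReal (Real.exp (-γ)) := by
          rw [Finset.sum_const, nsmul_eq_mul]
          gcongr
          exact (Finset.card_le_univ _).trans (by simp)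
  have hJ : (C.jointLaw σ) {p | C.dec p.1 (C.output p) ≠ p.2.1} ≤
      P B + M * ENNReal.ofReal (Real.exp (-γ)) := by
    rw [← lintegral_indicator_one C.measurableSet_error]
    refine (RandomCode.lintegral_jointLaw_swap _ _
      (measurable_const.indicator C.measurableSet_error)).trans_le ?_
    calc _ ≤ ∫⁻ _, (P B + M * ENNReal.ofReal (Real.exp (-γ)))
          ∂(uniformOn (Set.univ : Set (Fin M))) := by
          refine lintegral_mono fun m => le_trans (le_of_eq ?_) (herr m)
          have hm : MeasurableSet
              {q : (Fin M → Fin n → ℝ) × (Fin n → ℝ) | dec (q.1, q.1 m + q.2) ≠ m} :=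
            (measurableSet_eq_fun (hdec.comp (by fun_prop)) (by fun_prop)).compl
          rw [← lintegral_indicator_one hm]
          rfl
      _ = _ := by simp
  rw [RandomCode.errorProb, Measure.real]
  calc _ ≤ (P B + M * ENNReal.ofReal (Real.exp (-γ))).toReal :=
        ENNReal.toReal_mono (by finiteness) hJ
    _ = _ := by
        rw [ENNReal.toReal_add (by finiteness) (by finiteness), ENNReal.toReal_mul,
          ENNReal.toReal_ofReal (by positivity)]
        simp [Measure.real]

/-! ### Concentration of the information density -/

lemma integral_pow_four_gaussianReal (v : ℝ≥0) :
    ∫ x, x ^ 4 ∂(gaussianReal 0 v) = v ^ 2 * ∫ x, x ^ 4 ∂(gaussianReal 0 1) := by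
  have h := gaussianReal_map_const_mul (μ := 0) (v := 1) (NNReal.sqrt v : ℝ)
  have h2 : (NNReal.mk ((NNReal.sqrt v : ℝ) ^ 2) (sq_nonneg _)) * 1 = v := by
    ext; simp
  rw [h2, mul_zero] at h
  rw [← h, integral_map (by fun_prop) (by fun_prop), ← integral_const_mul]
  congr 1; ext x
  have : ((NNReal.sqrt v : ℝ)) ^ 2 = v := by simp
  rw [mul_pow, ← this]; ring

lemma integrable_pow_mul_pow_gaussian (u v : ℝ≥0) (a b : ℕ) :
    Integrable (fun q : ℝ × ℝ => q.1 ^ a * q.2 ^ b)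
      ((gaussianReal 0 u).prod (gaussianReal 0 v)) :=
  (integrable_pow_gaussianReal 0 u a).mul_prod (integrable_pow_gaussianReal 0 v b)

lemma integral_pow_mul_pow_gaussian (u v : ℝ≥0) (a b : ℕ) :
    ∫ q, q.1 ^ a * q.2 ^ b ∂((gaussianReal 0 u).prod (gaussianReal 0 v)) =
      (∫ x, x ^ a ∂(gaussianReal 0 u)) * ∫ x, x ^ b ∂(gaussianReal 0 v) :=
  integral_prod_mul (fun x => x ^ a) (fun x => x ^ b)

/-- The centred information density of a single channel use. -/
noncomputable def centredDensity (v w : ℝ≥0) (q : ℝ × ℝ) : ℝ :=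
  (q.1 + q.2) ^ 2 / (2 * w) - q.2 ^ 2 / (2 * v)

/-- Both normalised squares have mean 1/2, since the output variance is u + v. -/
lemma integral_centredDensity (u v : ℝ≥0) (hv : v ≠ 0) :
    ∫ q, centredDensity v (u + v) q ∂((gaussianReal 0 u).prod (gaussianReal 0 v)) = 0 := by
  have i1 : Integrable (fun q : ℝ × ℝ => q.1 ^ 2)
    ((gaussianReal 0 u).prod (gaussianReal 0 v)) := by
    simpa using integrable_pow_mul_pow_gaussian u v 2 0
  have i2 : Integrable (fun q : ℝ × ℝ => q.2 ^ 2)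
    ((gaussianReal 0 u).prod (gaussianReal 0 v)) := by
    simpa using integrable_pow_mul_pow_gaussian u v 0 2
  have i3 := integrable_pow_mul_pow_gaussian u v 1 1
  have e1 : ∫ q, q.1 ^ 2 ∂((gaussianReal 0 u).prod (gaussianReal 0 v)) = u := by
    simpa [integral_sq_gaussianReal] using integral_pow_mul_pow_gaussian u v 2 0
  have e2 : ∫ q, q.2 ^ 2 ∂((gaussianReal 0 u).prod (gaussianReal 0 v)) = v := by
    simpa [integral_sq_gaussianReal] using integral_pow_mul_pow_gaussian u v 0 2
  have e3 : ∫ q, q.1 ^ 1 * q.2 ^ 1 ∂((gaussianReal 0 u).prod (gaussianReal 0 v)) = 0 := by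
    simpa using integral_pow_mul_pow_gaussian u v 1 1
  have hq : centredDensity v (u + v) = fun q => (1 / (2 * (u + v) : ℝ)) * q.1 ^ 2 +
      (1 / (u + v : ℝ)) * (q.1 ^ 1 * q.2 ^ 1) + (1 / (2 * (u + v) : ℝ) - 1 / (2 * v)) * q.2 ^ 2 := by
    ext q
    have : (0 : ℝ) < v := by positivity
    have : (0 : ℝ) < u + v := by positivity
    simp only [centredDensity, NNReal.coe_add]
    field_simp
    ring
  have i12 := (i1.const_mul (1 / (2 * (u + v) : ℝ))).add (i3.const_mul (1 / (u + v : ℝ)))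
  rw [hq]
  refine (integral_add i12 (i2.const_mul _)).trans ?_
  have := integral_add (i1.const_mul (1 / (2 * (u + v) : ℝ))) (i3.const_mul (1 / (u + v : ℝ)))
  simp only [Pi.add_apply]
  rw [this, integral_const_mul, integral_const_mul, integral_const_mul, e1, e2, e3]
  have : (0 : ℝ) < v := by positivity
  have : (0 : ℝ) < u + v := by positivity
  field_simp
  ring

/-- The second moment is of first order in s, because the pure noise term carries a factor s before
squaring and the cross term has second moment proportional to s. Summed over n uses this is O(ns),
the order of √n for the later choice of s. -/
lemma integral_centredDensity_sq_le {v s : ℝ≥0} (hv : v ≠ 0) (hs : s ≤ 1) :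
    Integrable (fun q => centredDensity v (v * s + v) q ^ 2)
      ((gaussianReal 0 (v * s)).prod (gaussianReal 0 v)) ∧
    ∫ q, centredDensity v (v * s + v) q ^ 2 ∂((gaussianReal 0 (v * s)).prod (gaussianReal 0 v)) ≤
      (3 + 3 / 2 * ∫ x, x ^ 4 ∂(gaussianReal 0 1)) * s := by
  have hv' : (0 : ℝ) < v := by positivity
  have hs1 : (s : ℝ) ≤ 1 := by exact_mod_cast hs
  set μ := (gaussianReal 0 (v * s)).prod (gaussianReal 0 v) with hμ
  set m := ∫ x, x ^ 4 ∂(gaussianReal 0 1) with hm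
  have hm0 : 0 ≤ m := integral_nonneg fun x => by positivity
  have i1 : Integrable (fun q : ℝ × ℝ => q.1 ^ 4) μ := by
    simpa using integrable_pow_mul_pow_gaussian (v * s) v 4 0
  have i2 : Integrable (fun q : ℝ × ℝ => q.2 ^ 4) μ := by
    simpa using integrable_pow_mul_pow_gaussian (v * s) v 0 4
  have i3 : Integrable (fun q : ℝ × ℝ => q.1 ^ 2 * q.2 ^ 2) μ :=
    integrable_pow_mul_pow_gaussian (v * s) v 2 2
  have e1 : ∫ q, q.1 ^ 4 ∂μ = (v * s) ^ 2 * m := by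
    simpa [integral_pow_four_gaussianReal (v * s)] using
      integral_pow_mul_pow_gaussian (v * s) v 4 0
  have e2 : ∫ q, q.2 ^ 4 ∂μ = v ^ 2 * m := by
    simpa [integral_pow_four_gaussianReal v] using integral_pow_mul_pow_gaussian (v * s) v 0 4
  have e3 : ∫ q, q.1 ^ 2 * q.2 ^ 2 ∂μ = v * s * v := by
    simpa [integral_sq_gaussianReal] using integral_pow_mul_pow_gaussian (v * s) v 2 2
  have hle (q : ℝ × ℝ) : centredDensity v (v * s + v) q ^ 2 ≤
      3 / (4 * v ^ 2) * q.1 ^ 4 + 3 / v ^ 2 * (q.1 ^ 2 * q.2 ^ 2) +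
        3 * s ^ 2 / (4 * v ^ 2) * q.2 ^ 4 := by
    have heq : centredDensity v (v * s + v) q =
        (q.1 ^ 2 + 2 * (q.1 * q.2) - s * q.2 ^ 2) / (2 * (v * s + v)) := by
      have : (0 : ℝ) < v * s + v := by positivity
      have : (0 : ℝ) < s + 1 := by positivity
      simp only [centredDensity, NNReal.coe_add, NNReal.coe_mul]
      field_simp
      ring
    rw [heq, div_pow]
    calc _ ≤ (q.1 ^ 2 + 2 * (q.1 * q.2) - s * q.2 ^ 2) ^ 2 / (2 * v) ^ 2 := by
          gcongr
          have : (0 : ℝ) ≤ v * s := by positivity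
          linarith
      _ ≤ 3 * ((q.1 ^ 2) ^ 2 + (2 * (q.1 * q.2)) ^ 2 + (s * q.2 ^ 2) ^ 2) / (2 * v) ^ 2 := by
          gcongr
          nlinarith [sq_nonneg (q.1 ^ 2 - 2 * (q.1 * q.2)), sq_nonneg (q.1 ^ 2 + s * q.2 ^ 2),
            sq_nonneg (2 * (q.1 * q.2) + s * q.2 ^ 2)]
      _ = _ := by field_simp; ring
  have i13 : Integrable (fun q : ℝ × ℝ => 3 / (4 * (v : ℝ) ^ 2) * q.1 ^ 4 +
      3 / (v : ℝ) ^ 2 * (q.1 ^ 2 * q.2 ^ 2)) μ := (i1.const_mul _).add (i3.const_mul _)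
  have i : Integrable (fun q : ℝ × ℝ => 3 / (4 * (v : ℝ) ^ 2) * q.1 ^ 4 +
      3 / (v : ℝ) ^ 2 * (q.1 ^ 2 * q.2 ^ 2) + 3 * (s : ℝ) ^ 2 / (4 * (v : ℝ) ^ 2) * q.2 ^ 4) μ :=
    i13.add (i2.const_mul _)
  have hint : Integrable (fun q => centredDensity v (v * s + v) q ^ 2) μ := by
    refine i.mono' (Measurable.aestronglyMeasurable (by unfold centredDensity; fun_prop))
      (ae_of_all _ fun q => ?_)
    rw [Real.norm_of_nonneg (sq_nonneg _)]
    exact hle q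
  refine ⟨hint, (integral_mono hint i hle).trans ?_⟩
  rw [integral_add i13 (i2.const_mul _), integral_add (i1.const_mul _) (i3.const_mul _),
    integral_const_mul, integral_const_mul, integral_const_mul, e1, e2, e3]
  have : 3 / (4 * (v : ℝ) ^ 2) * ((v * s) ^ 2 * m) + 3 / v ^ 2 * (v * s * v) +
      3 * s ^ 2 / (4 * v ^ 2) * (v ^ 2 * m) = 3 * s + 3 / 2 * m * (s * s) := by
    field_simp; ring
  rw [this]
  have : (s : ℝ) * s ≤ s := mul_le_of_le_one_left s.2 hs1
  nlinarith [mul_le_mul_of_nonneg_left this (by positivity : 0 ≤ 3 / 2 * m)]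

lemma measure_infoDensity_le_le {v s : ℝ≥0} (hv : v ≠ 0) (hs : s ≤ 1) {γ : ℝ}
    (hγ : γ < n / 2 * Real.log (1 + s)) :
    ((gaussianPi (0 : Fin n → ℝ) (v * s)).prod (gaussianPi 0 v)).real
        {q | infoDensity v (v * s + v) (q.1, q.1 + q.2) ≤ γ} ≤
      n * ((3 + 3 / 2 * ∫ x, x ^ 4 ∂(gaussianReal 0 1)) * s) /
        (n / 2 * Real.log (1 + s) - γ) ^ 2 := by
  have hv' : (0 : ℝ) < v := by positivity
  obtain ⟨hi, hsq⟩ := integral_centredDensity_sq_le hv hs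
  set T := centredDensity v (v * s + v) with hT
  set ν := (gaussianReal 0 (v * s)).prod (gaussianReal 0 v) with hν
  have hTm : Measurable T := by unfold T centredDensity; fun_prop
  have hL2 : MemLp T 2 ν := (memLp_two_iff_integrable_sq hTm.aestronglyMeasurable).2 hi
  set S : (Fin n → ℝ × ℝ) → ℝ := ∑ i, fun q => T (q i) with hS
  have hSL2 : MemLp S 2 (Measure.pi fun _ => ν) := memLp_finsetSum' _ fun i _ =>
    hL2.comp_measurePreserving (measurePreserving_eval (fun _ => ν) i)
  have hmean : ∫ q, S q ∂(Measure.pi fun _ => ν) = 0 := by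
    simp only [hS, Finset.sum_apply]
    rw [integral_finsetSum]
    · refine Finset.sum_eq_zero fun i _ => ?_
      rw [integral_comp_eval (μ := fun _ : Fin n => ν) (f := T) (by fun_prop)]
      exact integral_centredDensity _ v hv
    · exact fun i _ => integrable_comp_eval (μ := fun _ : Fin n => ν) (hL2.integrable one_le_two)
  have hvar : variance S (Measure.pi fun _ => ν) ≤
      n * ((3 + 3 / 2 * ∫ x, x ^ 4 ∂(gaussianReal 0 1)) * s) := by
    rw [hS, variance_sum_pi (X := fun _ : Fin n => T) (μ := fun _ => ν) fun _ => hL2]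
    simp only [Finset.sum_const, Finset.card_univ, Fintype.card_fin, nsmul_eq_mul]
    gcongr
    exact (variance_le_expectation_sq hTm.aestronglyMeasurable).trans hsq
  have h1 := measurePreserving_arrowProdEquivProdArrow ℝ ℝ (Fin n)
    (fun _ => gaussianReal 0 (v * s)) (fun _ => gaussianReal 0 v)
  have hm : MeasurableSet {q : (Fin n → ℝ) × (Fin n → ℝ) |
      infoDensity v (v * s + v) (q.1, q.1 + q.2) ≤ γ} :=
    measurableSet_le (by fun_prop) (by fun_prop)
  set g := n / 2 * Real.log (1 + s) - γ with hg
  have hg0 : 0 < g := by linarith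
  -- Regrouping the two vectors as n independent pairs exhibits the information density as its mean
  -- plus a centred i.i.d. sum.
  have hid (q : Fin n → ℝ × ℝ) : infoDensity v (v * s + v)
      (fun i => (q i).1, (fun i => (q i).1) + fun i => (q i).2) =
      n / 2 * Real.log (1 + s) + S q := by
    have : ((v * s + v : ℝ≥0) : ℝ) / v = 1 + s := by push_cast; field_simp; ring
    rw [infoDensity, gaussianPiLLR_eq, this]
    simp [hS, hT, centredDensity, Finset.sum_div]
    ring
  have hmeas : ((gaussianPi (0 : Fin n → ℝ) (v * s)).prod (gaussianPi 0 v))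
        {q | infoDensity v (v * s + v) (q.1, q.1 + q.2) ≤ γ} ≤
      ENNReal.ofReal (variance S (Measure.pi fun _ => ν) / g ^ 2) := by
    refine le_trans ?_ (meas_ge_le_variance_div_sq hSL2 hg0)
    refine (h1.measure_preimage hm.nullMeasurableSet).symm.le.trans (measure_mono fun q hq => ?_)
    have hq' : infoDensity v (v * s + v)
      (fun i => (q i).1, (fun i => (q i).1) + fun i => (q i).2) ≤ γ := hq
    rw [hid] at hq'
    simp only [Set.mem_ofPred_eq, hmean, sub_zero]
    rw [abs_of_neg (by linarith)]
    linarith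
  refine (ENNReal.toReal_le_of_le_ofReal (div_nonneg (variance_nonneg _ _) (sq_nonneg _)) hmeas).trans ?_
  gcongr


/-! ### Choice of the signal-to-noise ratio and explicit rates -/

lemma sub_sq_div_two_le_log_one_add {s : ℝ} (hs : 0 ≤ s) : s - s ^ 2 / 2 ≤ Real.log (1 + s) := by
  refine le_trans ?_ (Real.le_log_one_add_of_nonneg hs)
  rw [le_div_iff₀ (by positivity)]
  have : 0 ≤ s ^ 3 := by positivity
  linarith

lemma log_one_add_le {s : ℝ} (hs : 0 ≤ s) (hs2 : s ≤ 1 / 2) :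
    Real.log (1 + s) ≤ s - s ^ 2 / 2 + 2 * s ^ 3 := by
  have h := Real.abs_log_sub_add_sum_range_le (x := -s)
    (by rw [abs_neg, abs_of_nonneg hs]; linarith) 2
  simp only [Finset.sum_range_succ, Finset.sum_range_zero, abs_neg, abs_of_nonneg hs,
    sub_neg_eq_add] at h
  have h2 : s ^ (2 + 1) / (1 - s) ≤ 2 * s ^ 3 := by
    rw [div_le_iff₀ (by linarith), show 2 + 1 = 3 from rfl]
    nlinarith [mul_nonneg (pow_nonneg hs 3) (by linarith : 0 ≤ 1 - 2 * s)]
  have h3 := (le_abs_self _).trans (h.trans h2)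
  norm_num at h3
  linarith

/-- The fourth-moment constant in the variance bound for the information density. -/
noncomputable def varianceConst : ℝ := 3 + 3 / 2 * ∫ x, x ^ 4 ∂(gaussianReal 0 1)

theorem achievable_of_le {σ : ℝ≥0} (hσ : σ ≠ 0) {δ ε η r : ℝ} (hδ : 0 < δ) (hr : 0 < r)
    {n M : ℕ} (hM : 0 < M) (hn : r ^ 2 = n * δ) (hr1 : 2 * δ ≤ r) (hη : 0 < η)
    (hηr : 2 * δ ≤ η * r) (hMr : M ≤ 2 * Real.exp ((1 - 2 * η) * r))
    (hε : 8 * varianceConst / (η ^ 2 * r) + 2 * Real.exp (-(η * r)) ≤ ε) :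
    Achievable σ δ ε n M := by
  have : NeZero M := ⟨hM.ne'⟩
  have hσ' : (0 : ℝ) < σ := by positivity
  have hn' : (n : ℝ) = r ^ 2 / δ := by rw [hn]; field_simp
  -- This s solves ns²/4 = δ, the divergence budget to second order; it also gives ns/2 = r.
  obtain ⟨s, hs⟩ : ∃ s : ℝ≥0, (s : ℝ) = 2 * δ / r := ⟨⟨2 * δ / r, by positivity⟩, rfl⟩
  have hs0 : (0 : ℝ) < s := by rw [hs]; positivity
  have hs1 : s ≤ 1 := by
    rw [← NNReal.coe_le_coe, hs, NNReal.coe_one, div_le_one hr]; exact hr1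
  have hlog := sub_sq_div_two_le_log_one_add hs0.le
  have hnlog : r - δ ≤ n / 2 * Real.log (1 + s) := by
    calc r - δ = n / 2 * (s - s ^ 2 / 2) := by rw [hn', hs]; field_simp
      _ ≤ _ := by gcongr
  have hns : (n : ℝ) * s = 2 * r := by rw [hn', hs]; field_simp
  have hgap : η * r / 2 ≤ n / 2 * Real.log (1 + s) - (1 - η) * r := by linarith
  have hηr0 : 0 < η * r := by positivity
  -- The threshold lies halfway between the rate (1 - 2η)r and r, leaving room of order ηr for both
  -- error events.
  obtain ⟨C, hC, hCerr⟩ := exists_gaussianCode (n := n) (M := M) hσ (σ ^ 2 * s) ((1 - η) * r)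
  have hC0 : 0 ≤ varianceConst :=
    add_nonneg (by norm_num) (mul_nonneg (by norm_num) (integral_nonneg fun x => by positivity))
  refine ⟨hM, C, ?_, hCerr.trans (le_trans (add_le_add ?_ ?_) hε)⟩
  · rw [hC]
    refine (klDiv_gaussianPi_le (pow_ne_zero 2 hσ) (by positivity)).trans
      (ENNReal.ofReal_le_ofReal ?_)
    have : (((σ ^ 2 * s + σ ^ 2 : ℝ≥0) : ℝ) / (σ ^ 2 : ℝ≥0)) = 1 + s := by
      push_cast; field_simp; ring
    rw [this]
    calc _ = n / 2 * s - n / 2 * Real.log (1 + s) := by ring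
      _ ≤ δ := by linarith
  · refine (measure_infoDensity_le_le (pow_ne_zero 2 hσ) hs1 (by linarith)).trans ?_
    calc _ ≤ n * (varianceConst * s) / (η * r / 2) ^ 2 := by
          rw [varianceConst] at hC0 ⊢
          gcongr
      _ = varianceConst * (n * s) / (η * r / 2) ^ 2 := by ring
      _ = _ := by rw [hns]; field_simp; ring
  · calc _ ≤ 2 * Real.exp ((1 - 2 * η) * r) * Real.exp (-((1 - η) * r)) := by gcongr
      _ = _ := by rw [mul_assoc, ← Real.exp_add]; congr 2; ring

theorem log_le_of_achievable {σ : ℝ≥0} (hσ : σ ≠ 0) {δ ε r : ℝ} (hδ : 0 < δ) (hr : 0 < r)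
    {n M : ℕ} (hn : r ^ 2 = n * δ) (hr1 : 4 * δ ≤ r) (h : Achievable σ δ ε n M) :
    (1 - ε) * Real.log M ≤ r + (1 + 4 * δ) := by
  obtain ⟨hM, C, hkl, herr⟩ := h
  have : NeZero M := ⟨hM.ne'⟩
  have hn' : (n : ℝ) = r ^ 2 / δ := by rw [hn]; field_simp
  obtain ⟨s, hs⟩ : ∃ s : ℝ≥0, (s : ℝ) = 2 * δ / r := ⟨⟨2 * δ / r, by positivity⟩, rfl⟩
  have hs0 : (0 : ℝ) < s := by rw [hs]; positivity
  have hs1 : (s : ℝ) ≤ 1 / 2 := by rw [hs, div_le_iff₀ hr]; linarith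
  refine (C.log_card_le hσ hδ.le hkl herr (s := s) (by exact_mod_cast hs0.ne')).trans ?_
  -- First order suffices for the rate term, but the energy term is divided by s and so needs the
  -- third-order bound. There n/2 cancels, and -ns/4 = -r/2 cancels δ/s = r/2; the cubic term leaves
  -- ns² = 4δ.
  have h1 : Real.log (1 + s) ≤ s := by
    have := Real.log_le_sub_one_of_pos (by positivity : (0 : ℝ) < 1 + s); linarith
  have h2 := log_one_add_le hs0.le hs1
  calc _ ≤ 1 + n / 2 * (s : ℝ) - n / 2 + (δ + n / 2 * (s - s ^ 2 / 2 + 2 * s ^ 3)) / s := by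
        gcongr
    _ = _ := by
        rw [hn', hs]; field_simp; ring

/-! ### Passage to the limit -/

lemma tendsto_sqrt_mul_atTop {δ : ℝ} (hδ : 0 < δ) :
    Tendsto (fun n : ℕ => √(n * δ)) atTop atTop :=
  Real.tendsto_sqrt_atTop.comp (tendsto_natCast_atTop_atTop.atTop_mul_const hδ)

theorem eventually_le_maxNats_div {σ : ℝ≥0} (hσ : σ ≠ 0) {δ ε η : ℝ} (hδ : 0 < δ) (hε : 0 < ε)
    (hη : 0 < η) (hη2 : η ≤ 1 / 2) :
    ∀ᶠ n : ℕ in atTop,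
      ((1 - 2 * η : ℝ) : EReal) ≤ maxNats σ δ ε n / ((√(n * δ) : ℝ) : EReal) := by
  have hR := tendsto_sqrt_mul_atTop hδ
  have hlim : Tendsto (fun r : ℝ => 8 * varianceConst / (η ^ 2 * r) + 2 * Real.exp (-(η * r)))
      atTop (𝓝 0) := by
    have h1 : Tendsto (fun r : ℝ => 8 * varianceConst / (η ^ 2 * r)) atTop (𝓝 0) :=
      tendsto_const_nhds.div_atTop (tendsto_id.const_mul_atTop (by positivity))
    have h2 : Tendsto (fun r : ℝ => 2 * Real.exp (-(η * r))) atTop (𝓝 (2 * 0)) :=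
      (Real.tendsto_exp_neg_atTop_nhds_zero.comp (tendsto_id.const_mul_atTop hη)).const_mul 2
    simpa using h1.add h2
  filter_upwards [hR.eventually (hlim.eventually (eventually_le_nhds hε)),
    hR.eventually_gt_atTop 0, hR.eventually_ge_atTop (2 * δ),
    hR.eventually_ge_atTop (2 * δ / η)] with n h1 h2 h3 h4
  set r := √(n * δ) with hr
  -- This is what makes rounding up to an integer M cost at most a factor 2.
  have hx : 1 ≤ Real.exp ((1 - 2 * η) * r) :=
    Real.one_le_exp (mul_nonneg (by linarith) h2.le)
  set M := ⌈Real.exp ((1 - 2 * η) * r)⌉₊ with hM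
  have hM1 : Real.exp ((1 - 2 * η) * r) ≤ M := Nat.le_ceil _
  have hM2 : (M : ℝ) ≤ 2 * Real.exp ((1 - 2 * η) * r) := by
    have := Nat.ceil_lt_add_one (zero_le_one.trans hx)
    linarith
  have hach : Achievable σ δ ε n M :=
    achievable_of_le hσ hδ h2 (Nat.ceil_pos.2 (Real.exp_pos _)) (Real.sq_sqrt (by positivity)) h3 hη
      (by rw [div_le_iff₀ hη] at h4; linarith) hM2 h1
  have hlog : (1 - 2 * η) * r ≤ Real.log M :=
    (Real.le_log_iff_exp_le ((Real.exp_pos _).trans_le hM1)).2 hM1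
  calc ((1 - 2 * η : ℝ) : EReal) ≤ ((Real.log M / r : ℝ) : EReal) :=
        EReal.coe_le_coe_iff.2 ((le_div_iff₀ h2).2 hlog)
    _ = (Real.log M : ℝ) / ((r : ℝ) : EReal) := EReal.coe_div _ _
    _ ≤ _ := EReal.div_le_div_right_of_nonneg (EReal.coe_nonneg.2 h2.le)
      (le_iSup₂ (f := fun (M : ℕ) (_ : Achievable σ δ ε n M) => ((Real.log M : ℝ) : EReal)) M hach)

theorem eventually_maxNats_div_le {σ : ℝ≥0} (hσ : σ ≠ 0) {δ ε : ℝ} (hδ : 0 < δ) (hε : ε < 1) :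
    ∀ᶠ n : ℕ in atTop, maxNats σ δ ε n / ((√(n * δ) : ℝ) : EReal) ≤
      (((1 + (1 + 4 * δ) / √(n * δ)) / (1 - ε) : ℝ) : EReal) := by
  have hR := tendsto_sqrt_mul_atTop hδ
  filter_upwards [hR.eventually_gt_atTop 0, hR.eventually_ge_atTop (4 * δ)] with n h1 h2
  set r := √(n * δ) with hr
  have hε' : 0 < 1 - ε := by linarith
  have hK : maxNats σ δ ε n ≤ (((r + (1 + 4 * δ)) / (1 - ε) : ℝ) : EReal) := by
    refine iSup₂_le fun M hM => EReal.coe_le_coe_iff.2 ?_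
    rw [le_div_iff₀ hε', mul_comm]
    exact log_le_of_achievable hσ hδ h1 (Real.sq_sqrt (by positivity)) h2 hM
  calc _ ≤ (((r + (1 + 4 * δ)) / (1 - ε) : ℝ) : EReal) / ((r : ℝ) : EReal) :=
        EReal.div_le_div_right_of_nonneg (EReal.coe_nonneg.2 h1.le) hK
    _ = _ := by
        rw [← EReal.coe_div]; congr 1; field_simp

theorem one_le_liminf_maxNats {σ : ℝ≥0} (hσ : σ ≠ 0) {δ ε : ℝ} (hδ : 0 < δ) (hε : 0 < ε) :
    (1 : EReal) ≤ liminf (fun n : ℕ => maxNats σ δ ε n / ((√(n * δ) : ℝ) : EReal)) atTop := by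
  have hlim : Tendsto (fun η : ℝ => ((1 - 2 * η : ℝ) : EReal)) (𝓝[>] 0) (𝓝 1) := by
    have : ContinuousAt (fun η : ℝ => ((1 - 2 * η : ℝ) : EReal)) 0 :=
      (continuous_coe_real_ereal.comp (by fun_prop)).continuousAt
    simpa using this.tendsto.mono_left nhdsWithin_le_nhds
  refine le_of_tendsto hlim ?_
  filter_upwards [Ioc_mem_nhdsGT (by norm_num : (0 : ℝ) < 1 / 2)] with η hη
  exact le_liminf_of_le (by isBoundedDefault)
    (eventually_le_maxNats_div hσ hδ hε hη.1 hη.2)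

theorem liminf_maxNats_le {σ : ℝ≥0} (hσ : σ ≠ 0) {δ ε : ℝ} (hδ : 0 < δ) (hε : ε < 1) :
    liminf (fun n : ℕ => maxNats σ δ ε n / ((√(n * δ) : ℝ) : EReal)) atTop ≤
      ((1 / (1 - ε) : ℝ) : EReal) := by
  have hlim : Tendsto (fun n : ℕ => (((1 + (1 + 4 * δ) / √(n * δ)) / (1 - ε) : ℝ) : EReal)) atTop
      (𝓝 ((1 / (1 - ε) : ℝ) : EReal)) := by
    refine (continuous_coe_real_ereal.tendsto _).comp (Tendsto.div_const ?_ _)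
    simpa using (tendsto_const_nhds (x := (1 : ℝ))).add
      ((tendsto_const_nhds (x := 1 + 4 * δ)).div_atTop (tendsto_sqrt_mul_atTop hδ))
  exact (liminf_le_liminf (eventually_maxNats_div_le hσ hδ hε)).trans hlim.liminf_eq.le

end CovertAWGN

/-- For the additive white Gaussian noise channel `Y = X + Z` with off symbol `0`, the constant
`L = lim_{ε ↓ 0} liminf_{n → ∞} K_n(δ, ε) / √(n δ)` equals `1`, whatever the noise variance. -/
theorem theorem5 (σ : ℝ≥0) (hσ : 0 < σ) (δ : ℝ) (hδ : 0 < δ) :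
    Tendsto
      (fun ε : ℝ => liminf
        (fun n : ℕ => CovertAWGN.maxNats σ δ ε n / ((Real.sqrt (n * δ) : ℝ) : EReal)) atTop)
      (𝓝[>] 0) (𝓝 (1 : EReal)) := by
  have hup : Tendsto (fun ε : ℝ => ((1 / (1 - ε) : ℝ) : EReal)) (𝓝[>] 0) (𝓝 1) := by
    have h : ContinuousAt (fun ε : ℝ => 1 / (1 - ε)) 0 :=
      ContinuousAt.div (by fun_prop) (by fun_prop) (by norm_num)
    have := (continuous_coe_real_ereal.continuousAt.comp h).tendsto.mono_left
      (nhdsWithin_le_nhds (s := Set.Ioi 0))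
    simpa [Function.comp_def] using this
  -- The lower bound 1 holds for every positive ε, the upper bound 1/(1 - ε) for ε < 1.
  refine tendsto_of_tendsto_of_tendsto_of_le_of_le' tendsto_const_nhds hup ?_ ?_
  · filter_upwards [self_mem_nhdsWithin] with ε hε
    exact CovertAWGN.one_le_liminf_maxNats hσ.ne' hδ hε
  · filter_upwards [Ioo_mem_nhdsGT (zero_lt_one (α := ℝ))] with ε hε
    exact CovertAWGN.liminf_maxNats_le hσ.ne' hδ hε.2
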